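/- Let $\lambda\in\mathbb R$. Let $\mathcal N(\lambda,3)$ be the set of polynomial maps $F=\lambda I+H:\mathbb R^3\to\mathbb R^3$, where $I$ is the identity and $H=(H_1,H_2,H_3)$ is a polynomial map whose Jacobian matrix is nilpotent at every point, and let $\mathcal N_{ld}(\lambda,3)$ be the subset of those $F$ for which $H_1,H_2,H_3$ are linearly dependent over $\mathbb R$. The origin is a global attractor of $\dot x=F(x)$ if $F(0)=0$ and, for every $x\in\mathbb R^3$, the solution starting at $x$ is defined for all $t>0$ and tends to $0$ as $t\to+\infty$; it is a global attractor of the iteration of $F$ if $F(0)=0$ and $F^m(x)\to 0$ as $m\to\infty$ for every $x\in\mathbb R^3$. **Theorem.** Let $F\in\mathcal N_{ld}(\lambda,3)$ with $F(0)=0$. 1. If $\lambda<0$ and the origin is not a global attractor of $\dot x=F(x)$, then this system has an orbit that escapes to infinity: there is a solution $\gamma$ with maximal forward interval of existence $[0,T)$, $0<T\le+\infty$, such that $\|\gamma(t)\|\to\infty$ as $t\to T^-$. 2. If $|\lambda|<1$ and the origin is not a global attractor of the iteration of $F$, then there is $x\in\mathbb R^3$ such that $\|F^m(x)\|\to\infty$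 as $m\to\infty$. -/

import Mathlib

open Filter Topology

/-- The polynomial self-map `x ↦ (H₁ x, …, Hₙ x)` of `ℝⁿ` given by a tuple of polynomials. -/
noncomputable def polyMap {n : ℕ} (H : Fin n → MvPolynomial (Fin n) ℝ) (x : Fin n → ℝ) :
    Fin n → ℝ :=
  fun i => MvPolynomial.eval x (H i)

/-- The Jacobian matrix `(∂Hᵢ/∂xⱼ)` at the point `x`. -/
noncomputable def polyJacobianAt {n : ℕ} (H : Fin n → MvPolynomial (Fin n) ℝ) (x : Fin n → ℝ) :
    Matrix (Fin n) (Fin n) ℝ :=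
  Matrix.of fun i j => MvPolynomial.eval x (MvPolynomial.pderiv j (H i))

/-- `F = lam • I + H` with `H` polynomial and the Jacobian matrix of `H` nilpotent at every
point. -/
def IsNilpotentForm {n : ℕ} (lam : ℝ) (H : Fin n → MvPolynomial (Fin n) ℝ)
    (F : (Fin n → ℝ) → (Fin n → ℝ)) : Prop :=
  (∀ x, F x = lam • x + polyMap H x) ∧ ∀ x, IsNilpotent (polyJacobianAt H x)

/-- The set `𝒩(lam, n)`. -/
def NSet (lam : ℝ) (n : ℕ) : Set ((Fin n → ℝ) → (Fin n → ℝ)) :=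
  {F | ∃ H : Fin n → MvPolynomial (Fin n) ℝ, IsNilpotentForm lam H F}

/-- The set `𝒩_ld(lam, n)`: the components of `H` are linearly dependent over `ℝ`. -/
def NldSet (lam : ℝ) (n : ℕ) : Set ((Fin n → ℝ) → (Fin n → ℝ)) :=
  {F | ∃ H : Fin n → MvPolynomial (Fin n) ℝ, IsNilpotentForm lam H F ∧ ¬ LinearIndependent ℝ H}

/-- `p` is a critical point of `ẋ = F x`, and every solution is defined for all positive times and
tends to `p`. -/
def IsGlobalAttractorFlow {n : ℕ} (F : (Fin n → ℝ) → (Fin n → ℝ)) (p : Fin n → ℝ) : Prop :=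
  F p = 0 ∧ ∀ x : Fin n → ℝ, ∃ γ : ℝ → (Fin n → ℝ), γ 0 = x ∧
    IsIntegralCurveOn γ (fun _ => F) (Set.Ici 0) ∧ Tendsto γ atTop (𝓝 p)

/-- `p` is a fixed point of `F`, and every sequence of iterates of `F` tends to `p`. -/
def IsGlobalAttractorIter {n : ℕ} (F : (Fin n → ℝ) → (Fin n → ℝ)) (p : Fin n → ℝ) : Prop :=
  F p = p ∧ ∀ x : Fin n → ℝ, Tendsto (fun m : ℕ => F^[m] x) atTop (𝓝 p)

/-- The set `𝒩_CY(lam, n)`. -/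
def NCYSet (lam : ℝ) (n : ℕ) : Set ((Fin n → ℝ) → (Fin n → ℝ)) :=
  {F | F ∈ NSet lam n ∧ IsGlobalAttractorFlow F 0}

/-- The set `𝒩_DY(lam, n)`. -/
def NDYSet (lam : ℝ) (n : ℕ) : Set ((Fin n → ℝ) → (Fin n → ℝ)) :=
  {F | F ∈ NSet lam n ∧ IsGlobalAttractorIter F 0}

/-- `γ` is a forward solution of `ẋ = F x` starting at time `0` that leaves every compact set as
time tends to the right end (`+∞`, or a finite `T > 0`) of its maximal interval of existence. A
solution on `[0, T)` that leaves every compact set as `t → T` cannot be continued, so maximality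
holds automatically. -/
def EscapesFlow {n : ℕ} (F : (Fin n → ℝ) → (Fin n → ℝ)) (γ : ℝ → (Fin n → ℝ)) : Prop :=
  (IsIntegralCurveOn γ (fun _ => F) (Set.Ici 0) ∧ Tendsto γ atTop (cocompact (Fin n → ℝ))) ∨
  ∃ T : ℝ, 0 < T ∧ IsIntegralCurveOn γ (fun _ => F) (Set.Ico 0 T) ∧
    Tendsto γ (𝓝[<] T) (cocompact (Fin n → ℝ))

/-- The sequence of iterates of `F` starting at `x` leaves every compact set. -/
def EscapesIter {n : ℕ} (F : (Fin n → ℝ) → (Fin n → ℝ)) (x : Fin n → ℝ) : Prop :=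
  Tendsto (fun m : ℕ => F^[m] x) atTop (cocompact (Fin n → ℝ))

/-! A linear relation among the components of H is a nonzero functional φ with φ ∘ H = 0, so φ ∘ F =
lam φ and φ decays along every orbit. An orbit that does not escape has a cluster point p, and p
lies on the plane φ = 0. It is enough that the basin of 0 contains a neighbourhood of each point of
that plane: every non-escaping orbit then tends to 0, so without escaping orbits the origin is a
global attractor.

On the plane, H induces a planar map with nilpotent Jacobian. By
`exists_linear_relation_of_nilpotent_planar` it is triangular, (m, l) ↦ (h l, 0), in suitable linear
coordinates. Weighting l heavily against m, and the transverse coordinate z = φ more heavily still,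
gives a norm and a ball around 0 containing p in which ‖H x‖ ≤ δ ‖x‖ (`exists_adapted_norm`). For
small δ the linear part dominates there, and orbits entering the ball converge to 0, for the flow
and for the iteration alike. -/

namespace MvPolynomial

/-! ### Planar polynomial maps with nilpotent Jacobian -/

theorem totalDegree_pderiv_lt {σ R : Type*} [CommSemiring R] {i : σ} {f : MvPolynomial σ R}
    (h : pderiv i f ≠ 0) : (pderiv i f).totalDegree < f.totalDegree := by
  obtain ⟨m, hm, hdeg⟩ := Finset.exists_mem_eq_sup (pderiv i f).support
    (support_nonempty.mpr h) (fun s => s.sum fun _ e => e)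
  have hm' : m + Finsupp.single i 1 ∈ f.support := by
    rw [mem_support_iff, coeff_pderiv] at hm
    exact mem_support_iff.mpr (left_ne_zero_of_mul hm)
  have hle := le_totalDegree hm'
  rw [Finsupp.sum_add_index' (fun _ => rfl) (fun _ _ _ => rfl),
    Finsupp.sum_single_index rfl] at hle
  have hdeg' : (pderiv i f).totalDegree = m.sum fun _ e => e := hdeg
  omega

theorem pderiv_comm {σ R : Type*} [CommSemiring R] (i j : σ) (f : MvPolynomial σ R) :
    pderiv i (pderiv j f) = pderiv j (pderiv i f) := by
  classical
  ext m
  rcases eq_or_ne i j with rfl | hij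
  · rfl
  simp only [coeff_pderiv, Finsupp.add_apply, Finsupp.single_apply, if_neg hij, if_neg hij.symm,
    add_zero, add_right_comm m (Finsupp.single i 1)]
  ring

theorem eq_C_of_pderiv_eq_zero {σ R : Type*} [CommRing R] [IsDomain R] [CharZero R]
    {f : MvPolynomial σ R} (h : ∀ i, pderiv i f = 0) : f = C (f.coeff 0) := by
  classical
  ext m
  rw [coeff_C]
  split_ifs with hm
  · rw [← hm]
  obtain ⟨i, hi⟩ : ∃ i, m i ≠ 0 := by
    by_contra! hc
    exact hm (Finsupp.ext fun i => (hc i).symm)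
  have hle : Finsupp.single i 1 ≤ m := by
    rw [Finsupp.single_le_iff]; omega
  have hc := coeff_pderiv (i := i) f (m - Finsupp.single i 1)
  rw [h i, coeff_zero, tsub_add_cancel_of_le hle] at hc
  rcases mul_eq_zero.mp hc.symm with h0 | h0
  · exact h0
  · exact absurd (by exact_mod_cast h0) (Nat.succ_ne_zero ((m - Finsupp.single i 1 : σ →₀ ℕ) i))

/-- A nonzero multiple of `f` has degree at least that of `f`, whereas a nonzero partial derivative
has smaller degree. -/
theorem pderiv_eq_zero_of_dvd {σ R : Type*} [CommRing R] [IsDomain R] {i : σ}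
    {f : MvPolynomial σ R} (h : f ∣ pderiv i f) : pderiv i f = 0 := by
  by_contra h0
  obtain ⟨q, hq⟩ := h
  have hf : f ≠ 0 := fun hf => h0 (by rw [hf, map_zero])
  have hq0 : q ≠ 0 := by
    rintro rfl
    exact h0 (by rw [hq, mul_zero])
  have h1 := totalDegree_pderiv_lt h0
  rw [hq, totalDegree_mul_of_isDomain hf hq0] at h1
  omega

/-- The first order operator `a ∂₀ - b ∂₁`, where `∂₀ a = k`, `∂₁ b = -k`, `∂₁ a = ∂₀ b = 0`, has
no negative multiple of `k` as an eigenvalue. -/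
theorem eq_zero_of_euler_eigenvector {a b : MvPolynomial (Fin 2) ℝ} {k : ℝ} (hk : k ≠ 0)
    (ha0 : pderiv 0 a = C k) (ha1 : pderiv 1 a = 0) (hb0 : pderiv 0 b = 0)
    (hb1 : pderiv 1 b = -C k) :
    ∀ (N : ℕ) (g : MvPolynomial (Fin 2) ℝ) (c : ℝ), 0 < c → g.totalDegree < N →
      a * pderiv 0 g - b * pderiv 1 g = -C (c * k) * g → g = 0 := by
  intro N
  induction N with
  | zero => intro g c _ h; omega
  | succ N ih =>
    intro g c hc hN hg
    have hx : pderiv 0 g = 0 := by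
      by_contra h0
      -- With D = a ∂₀ - b ∂₁, the commutator [∂₀, D] equals k ∂₀, so ∂₀ g is an eigenvector for -(c
      -- + 1) k of smaller degree.
      refine h0 (ih _ (c + 1) (by positivity)
        (by have := totalDegree_pderiv_lt h0; omega) ?_)
      have h := congrArg (pderiv 0) hg
      simp only [map_sub, map_mul, map_neg, Derivation.leibniz, smul_eq_mul, ha0, hb0,
        pderiv_C] at h
      rw [pderiv_comm 0 1] at h
      simp only [map_mul, map_add, map_one]
      linear_combination h
    have hy : pderiv 1 g = 0 := by
      by_contra h0
      refine h0 (ih _ (c + 1) (by positivity)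
        (by have := totalDegree_pderiv_lt h0; omega) ?_)
      have h := congrArg (pderiv 1) hg
      simp only [map_sub, map_mul, map_neg, Derivation.leibniz, smul_eq_mul, ha1, hb1,
        pderiv_C] at h
      rw [pderiv_comm 1 0] at h
      simp only [map_mul, map_add, map_one]
      linear_combination h
    rw [hx, hy, mul_zero, mul_zero, sub_zero] at hg
    rcases mul_eq_zero.mp hg.symm with h | h
    · rw [neg_eq_zero, C_eq_zero] at h
      exact absurd h (by positivity)
    · exact h

/-- A planar polynomial map with nilpotent Jacobian matrix has components that are linearly
dependent modulo constants. -/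
theorem exists_linear_relation_of_nilpotent_planar {P Q : MvPolynomial (Fin 2) ℝ}
    (htr : pderiv 0 P + pderiv 1 Q = 0)
    (hdet : pderiv 0 P * pderiv 1 Q - pderiv 1 P * pderiv 0 Q = 0) :
    ∃ r s : ℝ, (r ≠ 0 ∨ s ≠ 0) ∧
      C r * P + C s * Q = C (coeff 0 (C r * P + C s * Q)) := by
  have hQ1 : pderiv 1 Q = -pderiv 0 P := by linear_combination htr
  have key : ∀ r s : ℝ, C r * pderiv 0 P + C s * pderiv 0 Q = 0 →
      C r * pderiv 1 P + C s * pderiv 1 Q = 0 →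
      C r * P + C s * Q = C (coeff 0 (C r * P + C s * Q)) := by
    intro r s h0 h1
    refine eq_C_of_pderiv_eq_zero fun i => ?_
    fin_cases i
    · simpa [pderiv_C_mul] using h0
    · simpa [pderiv_C_mul] using h1
  rw [hQ1] at hdet
  by_cases hP1 : pderiv 1 P = 0
  · have hP0 : pderiv 0 P = 0 := by
      rw [hP1] at hdet
      exact mul_self_eq_zero.mp (by linear_combination -hdet)
    exact ⟨1, 0, Or.inl one_ne_zero, key 1 0 (by simp [hP0]) (by simp [hP1])⟩
  -- Removing the gcd d from the gradient of P leaves coprime a, b. The determinant then forces d =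
  -- a g, so that ∇P = (g a b, g a²) and ∇Q = (-g b², -g a b).
  obtain ⟨a, b, d, hab, had, hbd⟩ :=
    UniqueFactorizationMonoid.exists_reduced_factors (pderiv 1 P) hP1 (pderiv 0 P)
  have hd : d ≠ 0 := by rintro rfl; exact hP1 (by rw [← had, zero_mul])
  have ha : a ≠ 0 := by rintro rfl; exact hP1 (by rw [← had, mul_zero])
  have hda : a ∣ d := by
    have h : a * pderiv 0 Q = -(d * (b * b)) := by
      apply mul_left_cancel₀ hd
      rw [← had, ← hbd] at hdet
      linear_combination -hdet
    have h2 : a ∣ d * (b * b) := (dvd_neg).mp ⟨_, h.symm⟩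
    exact (hab.mul_right hab).dvd_of_dvd_mul_right h2
  obtain ⟨g, rfl⟩ := hda
  have hg : g ≠ 0 := right_ne_zero_of_mul hd
  have hQ0 : pderiv 0 Q = -(g * (b * b)) := by
    apply mul_left_cancel₀ (mul_ne_zero hd ha)
    rw [← had, ← hbd] at hdet
    linear_combination -hdet
  have hmP := pderiv_comm 0 1 P
  rw [← had, ← hbd] at hmP
  have hmQ := pderiv_comm 0 1 Q
  rw [hQ1, hQ0, ← hbd] at hmQ
  simp only [map_neg, Derivation.leibniz, smul_eq_mul] at hmP hmQ
  -- With D = a ∂₀ - b ∂₁, symmetry of the second derivatives of P and Q gives a E = g D a and b E =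
  -- g D b. Eliminating E yields a D b = b D a, and coprimality then gives a ∣ ∂₁ a and b ∣ ∂₀ b.
  set E : MvPolynomial (Fin 2) ℝ := pderiv 1 (g * b) - pderiv 0 (g * a) with hE
  simp only [Derivation.leibniz, smul_eq_mul] at hE
  have hEa : a * E = g * (a * pderiv 0 a - b * pderiv 1 a) := by
    rw [hE]; linear_combination -hmP
  have hEb : b * E = g * (a * pderiv 0 b - b * pderiv 1 b) := by
    rw [hE]; linear_combination hmQ
  have hcross : a * (a * pderiv 0 b - b * pderiv 1 b) = b * (a * pderiv 0 a - b * pderiv 1 a) := by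
    apply mul_left_cancel₀ hg
    linear_combination b * hEa - a * hEb
  have ha1 : pderiv 1 a = 0 := by
    apply pderiv_eq_zero_of_dvd
    apply hab.dvd_of_dvd_mul_left
    apply hab.dvd_of_dvd_mul_left
    exact ⟨b * pderiv 0 a - (a * pderiv 0 b - b * pderiv 1 b), by linear_combination hcross⟩
  have hb0 : pderiv 0 b = 0 := by
    apply pderiv_eq_zero_of_dvd
    apply hab.symm.dvd_of_dvd_mul_left
    apply hab.symm.dvd_of_dvd_mul_left
    exact ⟨a * pderiv 1 b + (a * pderiv 0 a - b * pderiv 1 a), by linear_combination hcross⟩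
  by_cases hb : b = 0
  · refine ⟨0, 1, Or.inr one_ne_zero, key 0 1 ?_ ?_⟩
    · rw [hQ0, hb]; simp
    · rw [hQ1, ← hbd, hb]; simp
  have hsum : pderiv 1 b = -pderiv 0 a := by
    apply mul_left_cancel₀ (mul_ne_zero ha hb)
    rw [ha1, hb0] at hcross
    linear_combination -hcross
  obtain ⟨k, hk⟩ : ∃ k, pderiv 0 a = C k := by
    refine ⟨_, eq_C_of_pderiv_eq_zero fun i => ?_⟩
    fin_cases i
    · have h := congrArg (pderiv 0) hsum
      rw [pderiv_comm 0 1, hb0] at h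
      simpa using h.symm
    · change pderiv 1 (pderiv 0 a) = 0
      rw [pderiv_comm 1 0, ha1, map_zero]
  rw [hk] at hsum
  -- Now E = k g, while expanding its definition gives E = -D g - 2 k g. Hence D g = -3 k g, which
  -- is impossible for g ≠ 0 unless k = 0.
  have hk0 : k = 0 := by
    by_contra hk0
    refine hg (eq_zero_of_euler_eigenvector hk0 hk ha1 hb0 hsum _ g 3 (by norm_num)
      (Nat.lt_succ_self _) ?_)
    have hEk : E = g * C k := by
      apply mul_left_cancel₀ ha
      rw [hEa, hk, ha1]; ring
    rw [hE, hk, hsum] at hEk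
    have h3 : (C (3 * k) : MvPolynomial (Fin 2) ℝ) = 3 * C k := by
      rw [map_mul, map_ofNat]
    rw [h3]
    linear_combination -hEk
  rw [hk0, C_0] at hk
  rw [hk0, C_0, neg_zero] at hsum
  have hac : a = C (coeff 0 a) := eq_C_of_pderiv_eq_zero (Fin.forall_fin_two.mpr ⟨hk, ha1⟩)
  have hbc : b = C (coeff 0 b) := eq_C_of_pderiv_eq_zero (Fin.forall_fin_two.mpr ⟨hb0, hsum⟩)
  refine ⟨coeff 0 b, coeff 0 a, Or.inr ?_, key _ _ ?_ ?_⟩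
  · intro h
    rw [h, C_0] at hac
    exact ha hac
  · rw [← hac, ← hbc, hQ0, ← hbd]; ring
  · rw [← hac, ← hbc, hQ1, ← hbd, ← had]; ring

end MvPolynomial

/-! ### Cluster points, maximal solutions and decay for the flow -/

theorem exists_mapClusterPt_of_not_tendsto_cocompact {X ι : Type*} [TopologicalSpace X]
    {l : Filter ι} {f : ι → X} (h : ¬ Tendsto f l (cocompact X)) : ∃ p, MapClusterPt p l f := by
  rw [hasBasis_cocompact.tendsto_right_iff] at h
  push Not at h
  obtain ⟨K, hK, hf⟩ := h
  obtain ⟨p, -, hp⟩ := hK.exists_mapClusterPt_of_frequently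
    (hf.mono fun x hx => Set.notMem_compl_iff.mp hx)
  exact ⟨p, hp⟩

section ODE

variable {E : Type*} [NormedAddCommGroup E] [NormedSpace ℝ E]

theorem IsIntegralCurveOn.hasDerivWithinAt_Ici {γ : ℝ → E} {v : ℝ → E → E} {a b t : ℝ}
    (h : IsIntegralCurveOn γ v (Set.Ico a b)) (ht : t ∈ Set.Ico a b) :
    HasDerivWithinAt γ (v t (γ t)) (Set.Ici t) t := by
  have h' := (h t ht).mono (Set.Ico_subset_Ico_left ht.1 : Set.Ico t b ⊆ Set.Ico a b)
  exact h'.mono_of_mem_nhdsWithin (Ico_mem_nhdsGE ht.2)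

/-- `F` is only locally Lipschitz, but on a compact time interval both curves stay in one ball,
where it is Lipschitz. -/
theorem IsIntegralCurveOn.eqOn_Ico [FiniteDimensional ℝ E] {F : E → E} (hF : ContDiff ℝ 1 F)
    {f g : ℝ → E} {a b : ℝ} (hf : IsIntegralCurveOn f (fun _ => F) (Set.Ico a b))
    (hg : IsIntegralCurveOn g (fun _ => F) (Set.Ico a b)) (h : f a = g a) :
    Set.EqOn f g (Set.Ico a b) := by
  intro t ht
  have hsub : Set.Icc a t ⊆ Set.Ico a b := fun s hs => ⟨hs.1, hs.2.trans_lt ht.2⟩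
  have hfc : ContinuousOn f (Set.Icc a t) := hf.continuousOn.mono hsub
  have hgc : ContinuousOn g (Set.Icc a t) := hg.continuousOn.mono hsub
  obtain ⟨R, hR⟩ := ((isCompact_Icc.image_of_continuousOn hfc).union
    (isCompact_Icc.image_of_continuousOn hgc)).isBounded.subset_closedBall (0 : E)
  obtain ⟨K, hK⟩ := hF.contDiffOn.exists_lipschitzOnWith one_ne_zero
    (convex_closedBall (0 : E) R) (isCompact_closedBall 0 R)
  have hIco : Set.Ico a t ⊆ Set.Ico a b := Set.Ico_subset_Ico_right ht.2.le
  refine ODE_solution_unique_of_mem_Icc_right (v := fun _ => F)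
    (s := fun _ => Metric.closedBall 0 R) (fun _ _ => hK) hfc
    (fun s hs => hf.hasDerivWithinAt_Ici (hIco hs)) (fun s hs => hR (Or.inl ?_)) hgc
    (fun s hs => hg.hasDerivWithinAt_Ici (hIco hs)) (fun s hs => hR (Or.inr ?_)) h
    ⟨ht.1, le_rfl⟩
  · exact Set.mem_image_of_mem f (Set.Ico_subset_Icc_self hs)
  · exact Set.mem_image_of_mem g (Set.Ico_subset_Icc_self hs)

theorem IsIntegralCurveOn.concat {v : ℝ → E → E} {f g : ℝ → E} {a b c : ℝ}
    (hab : a ≤ b) (hbc : b < c) (hf : IsIntegralCurveOn f v (Set.Icc a b))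
    (hg : IsIntegralCurveOn g v (Set.Ico b c)) (h : f b = g b) :
    IsIntegralCurveOn (fun t => if t < b then f t else g t) v (Set.Ico a c) := by
  have hl : Set.EqOn (fun t => if t < b then f t else g t) f (Set.Icc a b) := by
    intro s hs
    rcases hs.2.lt_or_eq with h1 | h1
    · simp [h1]
    · simp [h1, h]
  have hr : Set.EqOn (fun t => if t < b then f t else g t) g (Set.Ico b c) := by
    intro s hs
    simp [not_lt.mpr hs.1]
  have hl' : ∀ t ∈ Set.Icc a b, HasDerivWithinAt (fun t => if t < b then f t else g t)
      (v t (if t < b then f t else g t)) (Set.Icc a b) t := by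
    intro t ht
    have h1 := (hf t ht).congr hl (hl ht)
    rwa [← hl ht] at h1
  have hr' : ∀ t ∈ Set.Ico b c, HasDerivWithinAt (fun t => if t < b then f t else g t)
      (v t (if t < b then f t else g t)) (Set.Ico b c) t := by
    intro t ht
    have h1 := (hg t ht).congr hr (hr ht)
    rwa [← hr ht] at h1
  intro t ht
  rcases lt_trichotomy t b with h1 | rfl | h1
  · refine (hl' t ⟨ht.1, h1.le⟩).mono_of_mem_nhdsWithin ?_
    filter_upwards [self_mem_nhdsWithin, mem_nhdsWithin_of_mem_nhds (Iio_mem_nhds h1)]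
      with s hs hs' using ⟨hs.1, le_of_lt hs'⟩
  · have h2 := (hl' t ⟨hab, le_rfl⟩).union (hr' t ⟨le_rfl, hbc⟩)
    rwa [Set.Icc_union_Ico_eq_Ico hab hbc] at h2
  · refine (hr' t ⟨h1.le, ht.2⟩).mono_of_mem_nhdsWithin ?_
    filter_upwards [self_mem_nhdsWithin, mem_nhdsWithin_of_mem_nhds (Ioi_mem_nhds h1)]
      with s hs hs' using ⟨le_of_lt hs', hs.2⟩

/-- Every point is the origin of a forward solution of `ẋ = F x` that is global or leaves every
compact set in finite time. -/
theorem exists_maximal_isIntegralCurveOn [FiniteDimensional ℝ E] {F : E → E}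
    (hF : ContDiff ℝ 1 F) (x : E) :
    ∃ γ : ℝ → E, γ 0 = x ∧ (IsIntegralCurveOn γ (fun _ => F) (Set.Ici 0) ∨
      ∃ T : ℝ, 0 < T ∧ IsIntegralCurveOn γ (fun _ => F) (Set.Ico 0 T) ∧
        Tendsto γ (𝓝[<] T) (cocompact E)) := by
  classical
  have : CompleteSpace E := FiniteDimensional.complete ℝ E
  set S : Set ℝ := {b | 0 < b ∧ ∃ g : ℝ → E, g 0 = x ∧
    IsIntegralCurveOn g (fun _ => F) (Set.Ico 0 b)} with hS
  -- The existence time ε is uniform over a ball of initial points; this is what permits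
  -- continuation past the supremum of `S`.
  have hloc : ∀ p : E, ∃ r > (0 : ℝ), ∃ ε > (0 : ℝ), ∀ y ∈ Metric.closedBall p r,
      ∀ t₁ : ℝ, ∃ α : ℝ → E, α t₁ = y ∧
        IsIntegralCurveOn α (fun _ => F) (Set.Ico t₁ (t₁ + ε)) := by
    intro p
    obtain ⟨r, hr, ε, hε, H⟩ := hF.contDiffAt (x := p)
      |>.exists_forall_mem_closedBall_exists_eq_forall_mem_Ioo_hasDerivAt 0
    refine ⟨r, hr, ε, hε, fun y hy t₁ => ?_⟩
    obtain ⟨α, hα0, hα⟩ := H y hy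
    refine ⟨fun t => α (t - t₁), by simpa using hα0, fun t ht => ?_⟩
    have h1 := hα (t - t₁) ⟨by linarith [ht.1], by linarith [ht.2]⟩
    exact (h1.comp_sub_const t t₁).hasDerivWithinAt
  choose! sol hsol0 hsol using fun b (hb : b ∈ S) => hb.2
  have huniq : ∀ b ∈ S, ∀ c ∈ S, ∀ t, 0 ≤ t → t < b → t < c → sol b t = sol c t := by
    intro b hb c hc t ht htb htc
    have h1 := (hsol b hb).mono (Set.Ico_subset_Ico_right (min_le_left b c))
    have h2 := (hsol c hc).mono (Set.Ico_subset_Ico_right (min_le_right b c))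
    exact h1.eqOn_Ico hF h2 ((hsol0 b hb).trans (hsol0 c hc).symm) ⟨ht, lt_min htb htc⟩
  -- `β t` is an existence time beyond `t`. By uniqueness the diagonal curve `sol (β t) t` agrees
  -- with every `sol b` on its interval.
  choose! β hβS hβ using fun t (ht : ∃ b ∈ S, t < b) => ht
  have hΓ : ∀ b ∈ S, Set.EqOn (fun t => sol (β t) t) (sol b) (Set.Ico 0 b) := fun b hb t ht =>
    huniq _ (hβS t ⟨b, hb, ht.2⟩) b hb t ht.1 (hβ t ⟨b, hb, ht.2⟩) ht.2
  have hΓd : ∀ b ∈ S, IsIntegralCurveOn (fun t => sol (β t) t) (fun _ => F) (Set.Ico 0 b) := by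
    intro b hb t ht
    have h1 := (hsol b hb t ht).congr (hΓ b hb) (hΓ b hb ht)
    have h2 : sol (β t) t = sol b t := hΓ b hb ht
    simpa only [h2] using h1
  set Γ : ℝ → E := fun t => sol (β t) t with hΓdef
  obtain ⟨b₀, hb₀⟩ : S.Nonempty := by
    obtain ⟨r, hr, ε, hε, H⟩ := hloc x
    obtain ⟨α, hα0, hα⟩ := H x (Metric.mem_closedBall_self hr.le) 0
    rw [zero_add] at hα
    exact ⟨ε, hε, α, hα0, hα⟩
  refine ⟨Γ, (hΓ b₀ hb₀ ⟨le_rfl, hb₀.1⟩).trans (hsol0 b₀ hb₀), ?_⟩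
  by_cases hbdd : BddAbove S
  · right
    have hT : 0 < sSup S := hb₀.1.trans_le (le_csSup hbdd hb₀)
    have hcurve : IsIntegralCurveOn Γ (fun _ => F) (Set.Ico 0 (sSup S)) := by
      intro t ht
      obtain ⟨b, hb, htb⟩ := exists_lt_of_lt_csSup ⟨b₀, hb₀⟩ ht.2
      refine (hΓd b hb t ⟨ht.1, htb⟩).mono_of_mem_nhdsWithin ?_
      filter_upwards [self_mem_nhdsWithin, mem_nhdsWithin_of_mem_nhds (Iio_mem_nhds htb)]
        with s hs hs' using ⟨hs.1, hs'⟩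
    refine ⟨sSup S, hT, hcurve, ?_⟩
    by_contra hcon
    obtain ⟨p, hp⟩ := exists_mapClusterPt_of_not_tendsto_cocompact hcon
    obtain ⟨r, hr, ε, hε, H⟩ := hloc p
    have hfr := hp.frequently (Metric.closedBall_mem_nhds p hr)
    have hev : ∀ᶠ t in 𝓝[<] (sSup S), max 0 (sSup S - ε) < t ∧ t < sSup S := by
      filter_upwards [self_mem_nhdsWithin, mem_nhdsWithin_of_mem_nhds
        (Ioi_mem_nhds (max_lt hT (sub_lt_self _ hε)))] with t h1 h2 using ⟨h2, h1⟩
    -- Restarting near the cluster point, less than ε before the supremum, gives a solution that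
    -- outlives it.
    obtain ⟨t₁, ht₁, hlt, hltT⟩ := (hfr.and_eventually hev).exists
    obtain ⟨h0, h1⟩ := max_lt_iff.mp hlt
    obtain ⟨α, hα0, hα⟩ := H _ ht₁ t₁
    have hmem : t₁ + ε ∈ S := by
      refine ⟨by linarith, _, ?_, IsIntegralCurveOn.concat h0.le (by linarith)
        (hcurve.mono fun s hs => ⟨hs.1, hs.2.trans_lt hltT⟩) hα hα0.symm⟩
      simp only [h0, if_true]
      exact (hΓ b₀ hb₀ ⟨le_rfl, hb₀.1⟩).trans (hsol0 b₀ hb₀)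
    linarith [le_csSup hbdd hmem]
  · left
    intro t ht
    obtain ⟨b, hb, htb⟩ := not_bddAbove_iff.mp hbdd t
    refine (hΓd b hb t ⟨ht, htb⟩).mono_of_mem_nhdsWithin ?_
    filter_upwards [self_mem_nhdsWithin, mem_nhdsWithin_of_mem_nhds (Iio_mem_nhds htb)]
      with s hs hs' using ⟨hs, hs'⟩

/-- A solution of `ẋ = lam x + H x` that enters a ball in which `‖H x‖ ≤ δ ‖x‖`, in the norm
transported by `T`, tends to the origin if `lam + 2 δ < 0`. -/
theorem IsIntegralCurveOn.tendsto_zero_of_norm_le {G : Type*} [NormedAddCommGroup G]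
    [NormedSpace ℝ G] {lam δ R t₀ : ℝ} {F H : E → E} (T : E ≃L[ℝ] G) (hδ : 0 < δ)
    (hlam : lam + 2 * δ < 0) (hFH : ∀ x, F x = lam • x + H x)
    (hH : ∀ x, ‖T x‖ ≤ R → ‖T (H x)‖ ≤ δ * ‖T x‖) {γ : ℝ → E} (ht₀ : 0 ≤ t₀)
    (hγ : IsIntegralCurveOn γ (fun _ => F) (Set.Ici 0)) (h₀ : ‖T (γ t₀)‖ < R) :
    Tendsto γ atTop (𝓝 0) := by
  -- An intermediate r is positive even if `T (γ t₀) = 0`, which the strict comparison below needs.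
  obtain ⟨r, hr1, hr2⟩ := exists_between h₀
  have hr : 0 < r := (norm_nonneg _).trans_lt hr1
  -- The factor exp(-lam (t - t₀)) removes the linear term. The barrier grows at rate 2δ, not δ, so
  -- that its derivative is strictly larger at contact; at contact `‖T (γ t)‖ ≤ r < R`, so the bound
  -- on `H` applies.
  have key : ∀ t, t₀ ≤ t →
      ‖Real.exp (-lam * (t - t₀)) • T (γ t)‖ ≤ r * Real.exp (2 * δ * (t - t₀)) := by
    intro b hb
    refine image_norm_le_of_norm_deriv_right_lt_deriv_boundary (a := t₀) (b := b)
      (f := fun t => Real.exp (-lam * (t - t₀)) • T (γ t))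
      (f' := fun t => Real.exp (-lam * (t - t₀)) • T (H (γ t)))
      (B := fun t => r * Real.exp (2 * δ * (t - t₀)))
      (B' := fun t => r * (Real.exp (2 * δ * (t - t₀)) * (2 * δ))) ?_ ?_ ?_ ?_ ?_ ⟨hb, le_rfl⟩
    · refine ContinuousOn.smul (by fun_prop) (T.continuous.comp_continuousOn
        (hγ.continuousOn.mono fun s hs => ht₀.trans hs.1))
    · intro t ht
      have h1 : HasDerivWithinAt γ (F (γ t)) (Set.Ici t) t :=
        (hγ t (ht₀.trans ht.1)).mono (Set.Ici_subset_Ici.mpr (ht₀.trans ht.1))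
      have h2 := T.hasFDerivAt.comp_hasDerivWithinAt t h1
      have h3 : HasDerivAt (fun t => Real.exp (-lam * (t - t₀)))
          (Real.exp (-lam * (t - t₀)) * (-lam)) t := by
        have := (((hasDerivAt_id t).sub_const t₀).const_mul (-lam)).exp
        simpa using this
      refine (h3.hasDerivWithinAt.smul h2).congr_deriv ?_
      simp only [ContinuousLinearEquiv.coe_coe, hFH, map_add, map_smul, Function.comp]
      module
    · simpa using hr1.le
    · intro t
      have := ((((hasDerivAt_id t).sub_const t₀).const_mul (2 * δ)).exp).const_mul r
      simpa using this
    · intro t ht hB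
      rw [norm_smul, Real.norm_of_nonneg (Real.exp_pos _).le] at hB ⊢
      have hTγ : ‖T (γ t)‖ ≤ R := by
        have h1 : ‖T (γ t)‖ = r * Real.exp ((lam + 2 * δ) * (t - t₀)) := by
          apply mul_left_cancel₀ (Real.exp_pos (-lam * (t - t₀))).ne'
          rw [hB, mul_left_comm, ← Real.exp_add]
          congr 2; ring
        rw [h1]
        have h2 : Real.exp ((lam + 2 * δ) * (t - t₀)) ≤ 1 :=
          Real.exp_le_one_iff.mpr (mul_nonpos_of_nonpos_of_nonneg hlam.le (sub_nonneg.mpr ht.1))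
        nlinarith
      calc Real.exp (-lam * (t - t₀)) * ‖T (H (γ t))‖
          ≤ Real.exp (-lam * (t - t₀)) * (δ * ‖T (γ t)‖) := by
            gcongr; exact hH _ hTγ
        _ = δ * (r * Real.exp (2 * δ * (t - t₀))) := by rw [← hB]; ring
        _ < r * (Real.exp (2 * δ * (t - t₀)) * (2 * δ)) := by
            have := mul_pos hr (Real.exp_pos (2 * δ * (t - t₀)))
            nlinarith
  have hT : Tendsto (fun t => T (γ t)) atTop (𝓝 0) := by
    refine squeeze_zero_norm' (a := fun t => r * Real.exp ((lam + 2 * δ) * (t - t₀))) ?_ ?_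
    · filter_upwards [eventually_ge_atTop t₀] with t ht
      have h1 := key t ht
      rw [norm_smul, Real.norm_of_nonneg (Real.exp_pos _).le] at h1
      have h2 : r * Real.exp (2 * δ * (t - t₀))
          = Real.exp (-lam * (t - t₀)) * (r * Real.exp ((lam + 2 * δ) * (t - t₀))) := by
        rw [mul_left_comm, ← Real.exp_add]
        congr 2; ring
      rw [h2] at h1
      exact le_of_mul_le_mul_left h1 (Real.exp_pos _)
    · have h1 : Tendsto (fun t => (lam + 2 * δ) * (t - t₀)) atTop atBot :=
        (tendsto_atTop_add_const_right atTop (-t₀) tendsto_id).const_mul_atTop_of_neg hlam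
      simpa using (Real.tendsto_exp_atBot.comp h1).const_mul r
  have h := (T.symm.continuous.tendsto 0).comp hT
  simpa [Function.comp_def] using h

end ODE

/-! ### Linear substitution and directional derivatives -/

namespace MvPolynomial

theorem contDiff_eval {σ : Type*} [Fintype σ] (q : MvPolynomial σ ℝ) :
    ContDiff ℝ 1 fun x : σ → ℝ => eval x q :=
  contDiffOn_univ.mp ((AnalyticOnNhd.eval_mvPolynomial q).contDiffOn uniqueDiffOn_univ)

/-- Substitution of the linear forms given by the rows of `A` for the variables. -/
noncomputable def linearSubst {σ τ : Type*} [Fintype τ] (A : Matrix σ τ ℝ) :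
    MvPolynomial σ ℝ →ₐ[ℝ] MvPolynomial τ ℝ :=
  aeval fun j => ∑ k, C (A j k) * X k

theorem eval_linearSubst {σ τ : Type*} [Fintype τ] (A : Matrix σ τ ℝ) (u : τ → ℝ)
    (q : MvPolynomial σ ℝ) : eval u (linearSubst A q) = eval (A.mulVec u) q := by
  induction q using MvPolynomial.induction_on with
  | C a => simp [linearSubst]
  | add p q hp hq => rw [map_add, map_add, map_add, hp, hq]
  | mul_X p i hp =>
    rw [map_mul, map_mul, map_mul, hp]
    simp [linearSubst, Matrix.mulVec, dotProduct]

theorem pderiv_linearSubst {σ τ : Type*} [Fintype σ] [Fintype τ] (A : Matrix σ τ ℝ) (k : τ)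
    (q : MvPolynomial σ ℝ) :
    pderiv k (linearSubst A q) = ∑ j, C (A j k) * linearSubst A (pderiv j q) := by
  classical
  induction q using MvPolynomial.induction_on with
  | C a => simp [linearSubst]
  | add p q hp hq => simp only [map_add, hp, hq, mul_add, Finset.sum_add_distrib]
  | mul_X p i hp =>
    have h1 : pderiv k (linearSubst A (X i : MvPolynomial σ ℝ)) = C (A i k) := by
      simp only [linearSubst, aeval_X, map_sum, pderiv_C_mul, pderiv_X]
      rw [Finset.sum_eq_single k] <;> simp +contextual
    have h2 : ∀ j, linearSubst A (pderiv j (X i : MvPolynomial σ ℝ))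
        = if j = i then 1 else 0 := by
      intro j
      rcases eq_or_ne j i with rfl | h
      · simp
      · rw [pderiv_X_of_ne h.symm, if_neg h, map_zero]
    simp only [map_mul, Derivation.leibniz, smul_eq_mul, map_add, h1, h2, hp, mul_add,
      Finset.sum_add_distrib, Finset.mul_sum]
    congr 1
    · simp only [mul_ite, mul_one, mul_zero, Finset.sum_ite_eq', Finset.mem_univ, if_true]
      ring
    · exact Finset.sum_congr rfl fun j _ => by ring

theorem eval_add_smul_eq_of_pderiv {σ : Type*} [Fintype σ] {w : σ → ℝ} {q : MvPolynomial σ ℝ}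
    (h : ∑ i, C (w i) * pderiv i q = 0) (u : σ → ℝ) (t : ℝ) :
    eval (u + t • w) q = eval u q := by
  have hd : ∀ (p : MvPolynomial σ ℝ) (t : ℝ), HasDerivAt (fun t : ℝ => eval (u + t • w) p)
      (∑ i, w i * eval (u + t • w) (pderiv i p)) t := by
    classical
    intro p t
    induction p using MvPolynomial.induction_on with
    | C a => simpa using hasDerivAt_const t a
    | add p q hp hq =>
      simp only [map_add, mul_add, Finset.sum_add_distrib]
      exact hp.add hq
    | mul_X p i hp =>
      have h1 : HasDerivAt (fun t : ℝ => u i + t * w i) (w i) t := by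
        simpa using ((hasDerivAt_id t).mul_const (w i)).const_add (u i)
      have h2 := hp.mul h1
      simp only [map_mul, eval_X, Pi.add_apply, Pi.smul_apply, smul_eq_mul]
      refine h2.congr_deriv ?_
      simp only [Derivation.leibniz, smul_eq_mul, map_add, map_mul, eval_X, pderiv_X,
        Pi.add_apply, Pi.smul_apply]
      generalize u i + t * w i = c
      simp only [mul_add, Finset.sum_add_distrib, Finset.sum_mul]
      rw [add_comm]
      congr 1
      · rw [Finset.sum_eq_single i] <;> simp +contextual [mul_comm]
      · exact Finset.sum_congr rfl fun j _ => by ring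
  have h0 : ∀ t, HasDerivAt (fun t : ℝ => eval (u + t • w) q) 0 t := by
    intro t
    have h1 := congrArg (eval (u + t • w)) h
    simp only [map_sum, map_mul, eval_C, map_zero] at h1
    simpa [h1] using hd q t
  have := is_const_of_deriv_eq_zero (fun t => (h0 t).differentiableAt) (fun t => (h0 t).deriv) t 0
  simpa using this

end MvPolynomial

/-! ### Triangular form and weighted norms -/

open MvPolynomial

/-- Since `A * B` fixes the columns of `J`, the inner factors cancel: (BJA)^(k+1) = B J^(k+1) A. -/
theorem Matrix.isNilpotent_conj_of_mul_eq {m n : Type*} [Fintype m] [Fintype n] [DecidableEq m]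
    [DecidableEq n] {A : Matrix n m ℝ} {B : Matrix m n ℝ} {J : Matrix n n ℝ}
    (hAB : A * B * J = J) (hJ : IsNilpotent J) : IsNilpotent (B * J * A) := by
  have h : ∀ k : ℕ, (B * J * A) ^ (k + 1) = B * J ^ (k + 1) * A := by
    intro k
    induction k with
    | zero => simp
    | succ k ih =>
      rw [pow_succ, ih, pow_succ J (k + 1)]
      calc B * J ^ (k + 1) * A * (B * J * A) = B * J ^ (k + 1) * (A * B * J) * A := by
            simp only [Matrix.mul_assoc]
        _ = B * (J ^ (k + 1) * J) * A := by rw [hAB, Matrix.mul_assoc B]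
  obtain ⟨k, hk⟩ := hJ
  exact ⟨k + 1, by rw [h, pow_succ, hk]; simp⟩

theorem Matrix.det_eq_zero_of_isNilpotent {n : Type*} [Fintype n] [DecidableEq n] [Nonempty n]
    {M : Matrix n n ℝ} (h : IsNilpotent M) : M.det = 0 := by
  obtain ⟨k, hk⟩ := h
  have h1 : M.det ^ k = 0 := by
    rw [← Matrix.det_pow, hk, Matrix.det_zero]
  exact eq_zero_of_pow_eq_zero h1

/-- A planar polynomial map with everywhere nilpotent Jacobian matrix that fixes the origin is,
after a similarity, of the form `(m, l) ↦ (h l, 0)`. -/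
theorem exists_triangular_form_planar {P : Fin 2 → MvPolynomial (Fin 2) ℝ}
    (hnil : ∀ u, IsNilpotent (polyJacobianAt P u)) (h0 : polyMap P 0 = 0) :
    ∃ r s : ℝ, r ^ 2 + s ^ 2 ≠ 0 ∧
      (∀ u, r * polyMap P u 0 + s * polyMap P u 1 = 0) ∧
      ∀ u v : Fin 2 → ℝ, r * u 0 + s * u 1 = r * v 0 + s * v 1 →
        s * polyMap P u 0 - r * polyMap P u 1 = s * polyMap P v 0 - r * polyMap P v 1 := by
  have htr : pderiv 0 (P 0) + pderiv 1 (P 1) = 0 := by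
    refine MvPolynomial.funext fun u => ?_
    have h := (Matrix.isNilpotent_trace_of_isNilpotent (hnil u)).eq_zero
    simpa [Matrix.trace_fin_two, polyJacobianAt] using h
  have hdet : pderiv 0 (P 0) * pderiv 1 (P 1) - pderiv 1 (P 0) * pderiv 0 (P 1) = 0 := by
    refine MvPolynomial.funext fun u => ?_
    have h := Matrix.det_eq_zero_of_isNilpotent (hnil u)
    simpa [Matrix.det_fin_two, polyJacobianAt] using h
  obtain ⟨r, s, hrs, hrel⟩ := exists_linear_relation_of_nilpotent_planar htr hdet
  have hD : r ^ 2 + s ^ 2 ≠ 0 := by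
    rcases hrs with h | h
    · positivity
    · positivity
  have hx := congrArg (pderiv 0) hrel
  have hy := congrArg (pderiv 1) hrel
  rw [map_add, pderiv_C_mul, pderiv_C_mul, pderiv_C] at hx hy
  refine ⟨r, s, hD, fun u => ?_, fun u v huv => ?_⟩
  · have h1 := congrArg (eval u) hrel
    have h2 := congrArg (eval (0 : Fin 2 → ℝ)) hrel
    have h3 := congrFun h0 0
    have h4 := congrFun h0 1
    simp only [polyMap, Pi.zero_apply] at h3 h4 ⊢
    simp only [map_add, map_mul, eval_C, h3, h4] at h1 h2
    rw [h1]
    linarith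
  -- The vector (s, -r) spans the kernel of l = r u₀ + s u₁. The derivative of s P₀ - r P₁ along it
  -- is (r² + s²) times the trace, modulo the derivatives of r P₀ + s P₁.
  · have hq : ∑ i, C ((![s, -r] : Fin 2 → ℝ) i) * pderiv i (C s * P 0 - C r * P 1) = 0 := by
      simp only [Fin.sum_univ_two, Matrix.cons_val_zero, Matrix.cons_val_one, map_sub,
        pderiv_C_mul, map_neg]
      linear_combination (C s * C s + C r * C r) * htr - C r * hx - C s * hy
    have h1 := eval_add_smul_eq_of_pderiv hq v ((s * (u 0 - v 0) - r * (u 1 - v 1)) / (r ^ 2 + s ^ 2))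
    have hu : v + ((s * (u 0 - v 0) - r * (u 1 - v 1)) / (r ^ 2 + s ^ 2)) • ![s, -r] = u := by
      ext i
      fin_cases i
      · simp only [Fin.zero_eta, Pi.add_apply, Pi.smul_apply, Matrix.cons_val_zero, smul_eq_mul]
        field_simp
        linear_combination -r * huv
      · simp only [Fin.mk_one, Pi.add_apply, Pi.smul_apply, Matrix.cons_val_one, smul_eq_mul,
          Matrix.cons_val_fin_one]
        field_simp
        linear_combination -s * huv
    rw [hu] at h1
    simpa [polyMap] using h1

/-- The weighted norms `max |m| (A |l|) (B |z|)`: a map that is strictly triangular on the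
plane `z = 0` and has vanishing last component can be made small relative to the norm. -/
theorem exists_scaling_norm_le {G : ℝ × ℝ × ℝ → ℝ × ℝ × ℝ} (hG : ContDiff ℝ 1 G)
    (h0 : G 0 = 0) (h3 : ∀ y, (G y).2.2 = 0) (h2 : ∀ m l, (G (m, l, 0)).2.1 = 0)
    (h1 : ∀ m l, (G (m, l, 0)).1 = (G (0, l, 0)).1) (m₀ l₀ : ℝ) {δ : ℝ} (hδ : 0 < δ) :
    ∃ A B R : ℝ, 0 < A ∧ 0 < B ∧ ‖(m₀, A * l₀, (0 : ℝ))‖ < R ∧ ∀ m l z : ℝ,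
      ‖(m, A * l, B * z)‖ ≤ R →
        ‖((G (m, l, z)).1, A * (G (m, l, z)).2.1, B * (G (m, l, z)).2.2)‖
          ≤ δ * ‖(m, A * l, B * z)‖ := by
  have hlip : ∀ ρ : ℝ, ∃ K : NNReal, LipschitzOnWith K G (Metric.closedBall 0 ρ) := fun ρ =>
    hG.contDiffOn.exists_lipschitzOnWith one_ne_zero (convex_closedBall _ _)
      (isCompact_closedBall _ _)
  -- Order of choice: with R = A L, the ball bounds |l| by L whatever A is, so K₁ may be fixed
  -- before A and K₂ before B. A absorbs K₁ and exceeds |m₀|; B absorbs A K₂. The point (m₀, l₀, 0)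
  -- has z = 0, so B does not affect its norm.
  set L : ℝ := |l₀| + 1 with hL
  have hLpos : 0 < L := by positivity
  obtain ⟨K₁, hK₁⟩ := hlip L
  set A : ℝ := 1 + |m₀| + 2 * K₁ / δ with hA
  have hA1 : 1 ≤ A := by
    have : 0 ≤ |m₀| + 2 * K₁ / δ := by positivity
    linarith
  have hAK : 2 * K₁ ≤ A * δ := by
    have h : 2 * K₁ / δ * δ = 2 * (K₁ : ℝ) := div_mul_cancel₀ _ hδ.ne'
    have h' : 0 ≤ (1 + |m₀|) * δ := by positivity
    rw [hA, add_mul, h]; linarith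
  obtain ⟨K₂, hK₂⟩ := hlip (A * L)
  set B : ℝ := 1 + 2 * A * K₂ / δ with hB
  have hB1 : 1 ≤ B := by
    have : 0 ≤ 2 * A * K₂ / δ := by positivity
    linarith
  have hBK : 2 * A * K₂ ≤ B * δ := by
    have h : 2 * A * K₂ / δ * δ = 2 * A * (K₂ : ℝ) := div_mul_cancel₀ _ hδ.ne'
    rw [hB, add_mul, h]; linarith
  have hA0 : 0 < A := by linarith
  have hB0 : 0 < B := by linarith
  refine ⟨A, B, A * L, hA0, hB0, ?_, fun m l z hN => ?_⟩
  · have hm : |m₀| < A := by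
      have : 0 ≤ 2 * K₁ / δ := by positivity
      linarith
    simp only [Prod.norm_def, Real.norm_eq_abs, abs_mul, abs_of_pos hA0, abs_zero]
    refine max_lt ?_ (max_lt ?_ (by positivity))
    · nlinarith [abs_nonneg l₀]
    · nlinarith
  set N := ‖(m, A * l, B * z)‖ with hNdef
  have hmN : |m| ≤ N := norm_fst_le (m, A * l, B * z)
  have hlN : A * |l| ≤ N := by
    have h : ‖A * l‖ ≤ N := (norm_fst_le (A * l, B * z)).trans (norm_snd_le (m, A * l, B * z))
    rwa [Real.norm_eq_abs, abs_mul, abs_of_pos hA0] at h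
  have hzN : B * |z| ≤ N := by
    have h : ‖B * z‖ ≤ N := (norm_snd_le (A * l, B * z)).trans (norm_snd_le (m, A * l, B * z))
    rwa [Real.norm_eq_abs, abs_mul, abs_of_pos hB0] at h
  have hN0 : 0 ≤ N := norm_nonneg _
  have hl : |l| ≤ L := le_of_mul_le_mul_left (hlN.trans hN) hA0
  have hlAL : |l| ≤ A * L := hl.trans (by nlinarith)
  have hz : |z| ≤ A * L := by nlinarith [abs_nonneg z]
  have hmem : ∀ {ρ a b c : ℝ}, |a| ≤ ρ → |b| ≤ ρ → |c| ≤ ρ →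
      (a, b, c) ∈ Metric.closedBall (0 : ℝ × ℝ × ℝ) ρ := by
    intro ρ a b c ha hb hc
    rw [mem_closedBall_zero_iff]
    exact max_le ha (max_le hb hc)
  have hdiff : ‖G (m, l, z) - G (m, l, 0)‖ ≤ K₂ * |z| := by
    have h := hK₂.norm_sub_le (hmem (hmN.trans hN) hlAL hz)
      (hmem (hmN.trans hN) hlAL (by rw [abs_zero]; positivity))
    have h' : ‖((m, l, z) : ℝ × ℝ × ℝ) - (m, l, 0)‖ = |z| := by
      simp [Prod.norm_def]
    rwa [h'] at h
  have hbase : ‖G (0, l, 0)‖ ≤ K₁ * |l| := by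
    have h := hK₁.norm_sub_le (hmem (by rw [abs_zero]; positivity) hl
      (by rw [abs_zero]; positivity)) (Metric.mem_closedBall_self hLpos.le)
    have h' : ‖((0, l, 0) : ℝ × ℝ × ℝ)‖ = |l| := by
      simp [Prod.norm_def]
    rwa [h0, sub_zero, sub_zero, h'] at h
  have hK₂z : A * (K₂ * |z|) ≤ δ / 2 * N := by
    have h : B * (A * (K₂ * |z|)) ≤ B * (δ / 2 * N) := by
      have h1 : (A * K₂) * (B * |z|) ≤ (A * K₂) * N := by gcongr
      nlinarith
    exact le_of_mul_le_mul_left h hB0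
  have hK₁l : K₁ * |l| ≤ δ / 2 * N := by
    have h : (K₁ : ℝ) * |l| ≤ A * δ / 2 * |l| := by gcongr; linarith
    nlinarith
  refine max_le ?_ (max_le ?_ ?_)
  · have h4 : |(G (m, l, z)).1 - (G (m, l, 0)).1| ≤ K₂ * |z| :=
      (norm_fst_le (G (m, l, z) - G (m, l, 0))).trans hdiff
    have h5 : |(G (0, l, 0)).1| ≤ K₁ * |l| := (norm_fst_le _).trans hbase
    rw [h1] at h4
    have h6 : |(G (m, l, z)).1| ≤ |(G (m, l, z)).1 - (G (0, l, 0)).1| + |(G (0, l, 0)).1| := by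
      simpa using abs_add_le ((G (m, l, z)).1 - (G (0, l, 0)).1) (G (0, l, 0)).1
    have h7 : K₂ * |z| ≤ A * (K₂ * |z|) := le_mul_of_one_le_left (by positivity) hA1
    change |(G (m, l, z)).1| ≤ δ * N
    linarith
  · have h4 : |(G (m, l, z)).2.1 - (G (m, l, 0)).2.1| ≤ K₂ * |z| :=
      (norm_fst_le (G (m, l, z) - G (m, l, 0)).2).trans
        ((norm_snd_le (G (m, l, z) - G (m, l, 0))).trans hdiff)
    rw [h2, sub_zero] at h4
    change |A * (G (m, l, z)).2.1| ≤ δ * N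
    rw [abs_mul, abs_of_pos hA0]
    nlinarith
  · change |B * (G (m, l, z)).2.2| ≤ δ * N
    rw [h3, mul_zero, abs_zero]
    positivity


/-! ### Reduction to the invariant plane -/

theorem contDiff_polyMap {n : ℕ} (H : Fin n → MvPolynomial (Fin n) ℝ) :
    ContDiff ℝ 1 (polyMap H) :=
  contDiff_pi.mpr fun i => contDiff_eval (H i)

/-- A hyperplane of `ℝ³` has a linear parametrization with a linear left inverse. -/
theorem exists_parametrization_ker {φ : (Fin 3 → ℝ) →ₗ[ℝ] ℝ} (hφ : φ ≠ 0) :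
    ∃ (A : (Fin 2 → ℝ) →ₗ[ℝ] (Fin 3 → ℝ)) (B : (Fin 3 → ℝ) →ₗ[ℝ] (Fin 2 → ℝ)),
      (∀ u, B (A u) = u) ∧ (∀ u, φ (A u) = 0) ∧ ∀ x, φ x = 0 → A (B x) = x := by
  have hdim : Module.finrank ℝ (Fin 2 → ℝ) = Module.finrank ℝ (LinearMap.ker φ) := by
    have h := Module.Dual.finrank_ker_add_one_of_ne_zero (f := φ) hφ
    rw [Module.finrank_fin_fun] at h ⊢
    omega
  let e := LinearEquiv.ofFinrankEq _ _ hdim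
  obtain ⟨B, hB⟩ := ((LinearMap.ker φ).subtype ∘ₗ e.toLinearMap).exists_leftInverse_of_injective
    (LinearMap.ker_eq_bot.mpr ((LinearMap.ker φ).injective_subtype.comp e.injective))
  have hB' : ∀ u, B (e u : Fin 3 → ℝ) = u := fun u => LinearMap.congr_fun hB u
  refine ⟨(LinearMap.ker φ).subtype ∘ₗ e.toLinearMap, B, hB', fun u => (e u).2, fun x hx => ?_⟩
  obtain ⟨u, hu⟩ := e.surjective ⟨x, hx⟩
  have hx' : (e u : Fin 3 → ℝ) = x := by rw [hu]
  change ((e (B x) : LinearMap.ker φ) : Fin 3 → ℝ) = x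
  rw [← hx', hB']

/-- The restriction of a map with nilpotent Jacobian matrix and image in a hyperplane to that
hyperplane has nilpotent Jacobian matrix. -/
theorem exists_planar_restriction {H : Fin 3 → MvPolynomial (Fin 3) ℝ}
    (hnil : ∀ x, IsNilpotent (polyJacobianAt H x)) {c : Fin 3 → ℝ} (hc : ∑ i, c i • H i = 0)
    (A : (Fin 2 → ℝ) →ₗ[ℝ] (Fin 3 → ℝ)) (B : (Fin 3 → ℝ) →ₗ[ℝ] (Fin 2 → ℝ))
    (hAB : ∀ x, ∑ i, c i * x i = 0 → A (B x) = x) :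
    ∃ P : Fin 2 → MvPolynomial (Fin 2) ℝ, (∀ u, IsNilpotent (polyJacobianAt P u)) ∧
      ∀ u, polyMap P u = B (polyMap H (A u)) := by
  set MA := LinearMap.toMatrix' A with hMA
  set MB := LinearMap.toMatrix' B with hMB
  have hA : ∀ u, MA.mulVec u = A u := fun u => LinearMap.toMatrix'_mulVec A u
  have hB : ∀ x, MB.mulVec x = B x := fun x => LinearMap.toMatrix'_mulVec B x
  refine ⟨fun k => ∑ j, C (MB k j) * linearSubst MA (H j), fun u => ?_, fun u => ?_⟩
  · have hJ : polyJacobianAt (fun k => ∑ j, C (MB k j) * linearSubst MA (H j)) u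
        = MB * polyJacobianAt H (A u) * MA := by
      ext k l
      simp only [polyJacobianAt, Matrix.of_apply, Matrix.mul_apply, map_sum, pderiv_C_mul,
        pderiv_linearSubst, map_mul, eval_C, eval_linearSubst, hA, Finset.mul_sum,
        Finset.sum_mul]
      rw [Finset.sum_comm]
      exact Finset.sum_congr rfl fun i _ => Finset.sum_congr rfl fun j _ => by ring
    rw [hJ]
    refine Matrix.isNilpotent_conj_of_mul_eq ?_ (hnil _)
    ext i j
    -- Differentiating the relation shows that the columns of the Jacobian lie in the plane, where A
    -- ∘ B is the identity.
    have hcol : ∑ i, c i * (polyJacobianAt H (A u)).col j i = 0 := by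
      have h := congrArg (fun q => eval (A u) (pderiv j q)) hc
      simpa [polyJacobianAt, smul_eval] using h
    have h := congrFun (hAB _ hcol) i
    rw [← hB, ← hA, Matrix.mulVec_mulVec] at h
    exact h
  · rw [← hB]
    ext k
    simp [polyMap, Matrix.mulVec, dotProduct, eval_linearSubst, hA]

/-- In coordinates (m, l, z), with z the functional defined by `c` and m, l triangularizing the
restriction to z = 0, the map has the shape required by `exists_scaling_norm_le`. The weights depend
on `p`, so arbitrarily distant points of the plane are reached. -/
theorem exists_adapted_norm {H : Fin 3 → MvPolynomial (Fin 3) ℝ}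
    (hnil : ∀ x, IsNilpotent (polyJacobianAt H x)) (h0 : polyMap H 0 = 0) {c : Fin 3 → ℝ}
    (hc : ∑ i, c i • H i = 0) (hc0 : c ≠ 0) {p : Fin 3 → ℝ} (hp : ∑ i, c i * p i = 0) {δ : ℝ}
    (hδ : 0 < δ) :
    ∃ (T : (Fin 3 → ℝ) ≃L[ℝ] ℝ × ℝ × ℝ) (R : ℝ), ‖T p‖ < R ∧
      ∀ x, ‖T x‖ ≤ R → ‖T (polyMap H x)‖ ≤ δ * ‖T x‖ := by
  let φ : (Fin 3 → ℝ) →ₗ[ℝ] ℝ := ∑ i, c i • LinearMap.proj i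
  have hφ : ∀ x, φ x = ∑ i, c i * x i := fun x => by simp [φ]
  have hφ0 : φ ≠ 0 := by
    intro h
    refine hc0 (funext fun i => ?_)
    have h1 := hφ (Pi.single i 1)
    rw [h] at h1
    simpa [Pi.single_apply] using h1.symm
  have hφH : ∀ x, φ (polyMap H x) = 0 := by
    intro x
    have h := congrArg (eval x) hc
    rw [hφ]
    simpa [polyMap, smul_eval] using h
  obtain ⟨A, B, hBA, hφA, hAB⟩ := exists_parametrization_ker hφ0
  obtain ⟨P, hPnil, hP⟩ := exists_planar_restriction hnil hc A B
    (fun x hx => hAB x ((hφ x).trans hx))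
  obtain ⟨r, s, hD, hrel, hind⟩ := exists_triangular_form_planar hPnil
    (by rw [hP, map_zero, h0, map_zero])
  have hPx : ∀ x, φ x = 0 → polyMap P (B x) = B (polyMap H x) := fun x hx => by
    rw [hP, hAB x hx]
  let b : Fin 2 → (Fin 3 → ℝ) →ₗ[ℝ] ℝ := fun i => LinearMap.proj i ∘ₗ B
  let S₀ : (Fin 3 → ℝ) →ₗ[ℝ] ℝ × ℝ × ℝ := (s • b 0 - r • b 1).prod ((r • b 0 + s • b 1).prod φ)
  have hS₀ : ∀ x, S₀ x = (s * B x 0 - r * B x 1, r * B x 0 + s * B x 1, φ x) := fun x => rfl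
  have hinj : Function.Injective S₀ := by
    rw [← LinearMap.ker_eq_bot, LinearMap.ker_eq_bot']
    intro x hx
    rw [hS₀, Prod.mk_eq_zero, Prod.mk_eq_zero] at hx
    obtain ⟨h1, h2, h3⟩ := hx
    have hBx : B x = 0 := by
      ext i
      fin_cases i
      · refine (mul_eq_zero.mp ?_).resolve_left hD
        simp only [Fin.zero_eta]
        linear_combination s * h1 + r * h2
      · refine (mul_eq_zero.mp ?_).resolve_left hD
        simp only [Fin.mk_one]
        linear_combination s * h2 - r * h1
    rw [← hAB x h3, hBx, map_zero]
  let S : (Fin 3 → ℝ) ≃L[ℝ] ℝ × ℝ × ℝ :=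
    (LinearMap.linearEquivOfInjective S₀ hinj (by simp)).toContinuousLinearEquiv
  have hS : ∀ x, S x = (s * B x 0 - r * B x 1, r * B x 0 + s * B x 1, φ x) := hS₀
  have hS' : ∀ m l z, s * B (S.symm (m, l, z)) 0 - r * B (S.symm (m, l, z)) 1 = m ∧
      r * B (S.symm (m, l, z)) 0 + s * B (S.symm (m, l, z)) 1 = l ∧
      φ (S.symm (m, l, z)) = z := by
    intro m l z
    have h := (hS _).symm.trans (S.apply_symm_apply (m, l, z))
    simpa [Prod.ext_iff] using h
  obtain ⟨a, b', R, ha, hb, hpR, hbound⟩ := exists_scaling_norm_le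
    (G := fun y => S (polyMap H (S.symm y)))
    (S.contDiff.comp ((contDiff_polyMap H).comp S.symm.contDiff))
    (by rw [map_zero, h0, map_zero])
    (fun y => by rw [hS]; exact hφH _)
    (fun m l => by
      obtain ⟨-, -, h3⟩ := hS' m l 0
      rw [hS, ← hPx _ h3]
      exact hrel _)
    (fun m l => by
      obtain ⟨-, h2, h3⟩ := hS' m l 0
      obtain ⟨-, h2', h3'⟩ := hS' 0 l 0
      rw [hS, hS, ← hPx _ h3, ← hPx _ h3']
      exact hind _ _ (h2.trans h2'.symm))
    (S p).1 (S p).2.1 hδ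
  let T : (Fin 3 → ℝ) ≃L[ℝ] ℝ × ℝ × ℝ :=
    S.trans ((ContinuousLinearEquiv.refl ℝ ℝ).prodCongr
      ((ContinuousLinearEquiv.unitsEquivAut ℝ (Units.mk0 a ha.ne')).prodCongr
        (ContinuousLinearEquiv.unitsEquivAut ℝ (Units.mk0 b' hb.ne'))))
  have hT : ∀ x, T x = ((S x).1, a * (S x).2.1, b' * (S x).2.2) := by
    intro x
    simp [T, mul_comm]
  refine ⟨T, R, ?_, fun x hx => ?_⟩
  · have h3 : (S p).2.2 = 0 := by
      rw [hS]; exact (hφ p).trans hp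
    rw [hT, h3, mul_zero]
    exact hpR
  · rw [hT] at hx ⊢
    rw [hT]
    have h := hbound (S x).1 (S x).2.1 (S x).2.2 hx
    simpa only [Prod.mk.eta, S.symm_apply_apply] using h

/-! ### Convergence of orbits and the main theorem -/

/-- In the norm transported by `T`, `F` shrinks points of the ball by the factor |lam| + δ < 1, so
the orbit never leaves it again. -/
theorem tendsto_iterate_zero_of_norm_le {E G : Type*} [NormedAddCommGroup E] [NormedSpace ℝ E]
    [NormedAddCommGroup G] [NormedSpace ℝ G] {lam δ R : ℝ} {F H : E → E} (T : E ≃L[ℝ] G)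
    (hδ : 0 < δ) (hlam : |lam| + δ < 1) (hFH : ∀ x, F x = lam • x + H x)
    (hH : ∀ x, ‖T x‖ ≤ R → ‖T (H x)‖ ≤ δ * ‖T x‖) {x : E} {m₀ : ℕ} (h₀ : ‖T (F^[m₀] x)‖ < R) :
    Tendsto (fun m : ℕ => F^[m] x) atTop (𝓝 0) := by
  have hρ : 0 ≤ |lam| + δ := by positivity
  have hstep : ∀ y, ‖T y‖ ≤ R → ‖T (F y)‖ ≤ (|lam| + δ) * ‖T y‖ := by
    intro y hy
    rw [hFH, map_add, map_smul, add_mul]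
    exact (norm_add_le _ _).trans (add_le_add (norm_smul_le _ _) (hH y hy))
  have key : ∀ k : ℕ, ‖T (F^[k + m₀] x)‖ ≤ (|lam| + δ) ^ k * ‖T (F^[m₀] x)‖ := by
    intro k
    induction k with
    | zero => simp
    | succ k ih =>
      have h1 : ‖T (F^[k + m₀] x)‖ ≤ R :=
        (ih.trans (mul_le_of_le_one_left (norm_nonneg _) (pow_le_one₀ hρ hlam.le))).trans h₀.le
      rw [Nat.succ_add, Function.iterate_succ_apply', pow_succ', mul_assoc]
      exact (hstep _ h1).trans (mul_le_mul_of_nonneg_left ih hρ)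
  have hT : Tendsto (fun k => T (F^[k + m₀] x)) atTop (𝓝 0) := by
    refine squeeze_zero_norm key ?_
    simpa using (tendsto_pow_atTop_nhds_zero_of_lt_one hρ hlam).mul_const ‖T (F^[m₀] x)‖
  have h := (T.symm.continuous.tendsto 0).comp hT
  rw [map_zero] at h
  refine (tendsto_add_atTop_iff_nat m₀).mp ?_
  simpa [Function.comp_def] using h

theorem MapClusterPt.apply_eq_of_tendsto {ι X Y : Type*} [TopologicalSpace X]
    [TopologicalSpace Y] [T2Space Y] {l : Filter ι} {u : ι → X} {f : X → Y} {p : X} {y : Y}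
    (hp : MapClusterPt p l u) (hf : Continuous f) (h : Tendsto (fun i => f (u i)) l (𝓝 y)) :
    f p = y := by
  have h1 : MapClusterPt (f p) l (f ∘ u) := hp.continuousAt_comp hf.continuousAt
  have h2 : ClusterPt (f p) (𝓝 y) := ClusterPt.mono h1 h
  exact eq_of_nhds_neBot h2

/-- A linear functional `φ` with `φ ∘ F = lam φ`, `lam < 0`, decays along the solutions of
`ẋ = F x`. -/
theorem IsIntegralCurveOn.tendsto_linear_zero {E : Type*} [NormedAddCommGroup E]
    [NormedSpace ℝ E] {F : E → E} {lam : ℝ} (hlam : lam < 0) (φ : E →L[ℝ] ℝ)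
    (hφ : ∀ x, φ (F x) = lam * φ x) {γ : ℝ → E}
    (hγ : IsIntegralCurveOn γ (fun _ => F) (Set.Ici 0)) :
    Tendsto (fun t => φ (γ t)) atTop (𝓝 0) := by
  -- Along a solution φ satisfies the scalar equation y' = lam y, so exp(-lam t) φ(γ t) is constant.
  have hconst : ∀ t ∈ Set.Ici (0 : ℝ), Real.exp (-lam * t) * φ (γ t) = φ (γ 0) := by
    intro b hb
    have h := constant_of_has_deriv_right_zero (a := 0) (b := b)
      (f := fun t => Real.exp (-lam * t) * φ (γ t)) ?_ ?_ b ⟨hb, le_rfl⟩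
    · simpa using h
    · exact ContinuousOn.mul (by fun_prop) (φ.continuous.comp_continuousOn
        (hγ.continuousOn.mono fun s hs => hs.1))
    · intro t ht
      have h1 : HasDerivWithinAt γ (F (γ t)) (Set.Ici t) t :=
        (hγ t ht.1).mono (Set.Ici_subset_Ici.mpr ht.1)
      have h2 := φ.hasFDerivAt.comp_hasDerivWithinAt t h1
      have h3 : HasDerivAt (fun t => Real.exp (-lam * t)) (Real.exp (-lam * t) * (-lam)) t := by
        simpa using ((hasDerivAt_id t).const_mul (-lam)).exp
      refine (h3.hasDerivWithinAt.mul h2).congr_deriv ?_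
      simp only [hφ, Function.comp]
      ring
  have h : Tendsto (fun t => Real.exp (lam * t) * φ (γ 0)) atTop (𝓝 0) := by
    simpa using (Real.tendsto_exp_atBot.comp
      (tendsto_id.const_mul_atTop_of_neg hlam)).mul_const (φ (γ 0))
  refine h.congr' ?_
  filter_upwards [eventually_ge_atTop 0] with t ht
  rw [← hconst t ht, ← mul_assoc, ← Real.exp_add]
  simp

theorem mainTheorem7 (lam : ℝ) (F : (Fin 3 → ℝ) → (Fin 3 → ℝ))
    (hF : F ∈ NldSet lam 3) (hF0 : F 0 = 0) :
    (lam < 0 → F ∉ NCYSet lam 3 → ∃ γ : ℝ → (Fin 3 → ℝ), EscapesFlow F γ) ∧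
    (|lam| < 1 → F ∉ NDYSet lam 3 → ∃ x : Fin 3 → ℝ, EscapesIter F x) := by
  obtain ⟨H, ⟨hFH, hnil⟩, hdep⟩ := hF
  obtain ⟨c, hc, i, hi⟩ := Fintype.not_linearIndependent_iff.mp hdep
  have hc0 : c ≠ 0 := fun h => hi (congrFun h i)
  have hH0 : polyMap H 0 = 0 := by
    have h := hFH 0
    rwa [hF0, smul_zero, zero_add, eq_comm] at h
  let φ : (Fin 3 → ℝ) →L[ℝ] ℝ := ∑ i, c i • ContinuousLinearMap.proj i
  have hφ : ∀ x, φ x = ∑ i, c i * x i := fun x => by simp [φ]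
  have hφF : ∀ x, φ (F x) = lam * φ x := by
    intro x
    have h := congrArg (eval x) hc
    have h' : φ (polyMap H x) = 0 := by
      rw [hφ]
      simpa [polyMap, smul_eval] using h
    rw [hFH, map_add, map_smul, h', add_zero, smul_eq_mul]
  constructor
  · intro hlam hN
    by_contra! hesc
    refine hN ⟨⟨H, hFH, hnil⟩, hF0, fun x => ?_⟩
    have hFc : ContDiff ℝ 1 F := by
      rw [show F = fun x => lam • x + polyMap H x from funext hFH]
      exact (contDiff_id.const_smul lam).add (contDiff_polyMap H)
    obtain ⟨γ, hγ0, hγ | hγ⟩ := exists_maximal_isIntegralCurveOn hFc x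
    · refine ⟨γ, hγ0, hγ, ?_⟩
      obtain ⟨p, hp⟩ := exists_mapClusterPt_of_not_tendsto_cocompact
        fun h => hesc γ (Or.inl ⟨hγ, h⟩)
      have hpφ := hp.apply_eq_of_tendsto φ.continuous (hγ.tendsto_linear_zero hlam φ hφF)
      -- This δ gives lam + 2δ = lam / 2 < 0.
      have hδ : 0 < -lam / 4 := by linarith
      obtain ⟨T, R, hTp, hT⟩ := exists_adapted_norm hnil hH0 hc hc0 ((hφ p).symm.trans hpφ) hδ
      have hfr := hp.frequently
        ((isOpen_lt (T.continuous.norm) continuous_const).mem_nhds hTp)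
      obtain ⟨t₀, hR, ht₀⟩ := (hfr.and_eventually (eventually_ge_atTop 0)).exists
      exact hγ.tendsto_zero_of_norm_le T hδ (by linarith) hFH hT ht₀ hR
    · exact absurd (Or.inr hγ) (hesc γ)
  · intro hlam hN
    by_contra! hesc
    refine hN ⟨⟨H, hFH, hnil⟩, hF0, fun x => ?_⟩
    obtain ⟨p, hp⟩ := exists_mapClusterPt_of_not_tendsto_cocompact (hesc x)
    have hiter : ∀ m : ℕ, φ (F^[m] x) = lam ^ m * φ x := by
      intro m
      induction m with
      | zero => simp
      | succ m ih => rw [Function.iterate_succ_apply', hφF, ih, pow_succ', mul_assoc]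
    have hpφ : φ p = 0 := by
      refine hp.apply_eq_of_tendsto φ.continuous ?_
      simp only [hiter]
      simpa using (tendsto_pow_atTop_nhds_zero_of_abs_lt_one hlam).mul_const (φ x)
    -- This δ gives |lam| + δ = (1 + |lam|) / 2 < 1.
    have hδ : 0 < (1 - |lam|) / 2 := by linarith
    obtain ⟨T, R, hTp, hT⟩ := exists_adapted_norm hnil hH0 hc hc0 ((hφ p).symm.trans hpφ) hδ
    obtain ⟨m₀, hR⟩ := (hp.frequently
      ((isOpen_lt (T.continuous.norm) continuous_const).mem_nhds hTp)).exists
    exact tendsto_iterate_zero_of_norm_le T hδ (by linarith) hFH hT hR
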